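/- Call a function $G:\mathbb{R}\to\mathbb{C}$ tempered if $G(x)/(1+|x|)^n$ is Lebesgue integrable on $\mathbb{R}$ for some $n\in\mathbb{N}$. A frequency response is a tempered function $\omega\mapsto H(j\omega)$ of the real angular frequency $\omega$. Its impulse response is its inverse Fourier transform $$h(t)=\int_{-\infty}^{\infty}H(j\omega)\,e^{j\omega t}\,\frac{d\omega}{2\pi},$$ taken in the sense of tempered distributions. $H(j\omega)$ is causal if $h(t)=0$ for $t<0$, i.e. if $\langle h,\varphi\rangle=0$ for every Schwartz function $\varphi$ with support in $(-\infty,0)$. Theorem. Let $F(j\omega)$ be a minimum-phase filter: $F(j\omega)\neq 0$ for almost every $\omega$, and both $F(j\omega)$ and $1/F(j\omega)$ are (tempered and) causal. Let $H(j\omega)$ be a frequency response such that the filtered response $H_F(j\omega)=F(j\omega)H(j\omega)$ is also tempered, and let $h_F$ be the inverse Fourier transform of $H_F$. Then $H(j\omega)$ is causal if and only if $h_F(t)=0$ for $t<0$ (in the sense of distributions). If moreover $H_F$ is integrable, so that $h_F$ is the continuous function given by the ordinary integral $h_F(t)=\int_{-\infty}^{\infty}F(j\omega)H(j\omega)e^{j\omega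 t}\,\frac{d\omega}{2\pi}$, then $H(j\omega)$ is causal if and only if $h_F(t)=0$ for every real $t<0$. -/

import Mathlib

open MeasureTheory Distribution
open scoped SchwartzMap FourierTransform

noncomputable section

namespace CausalityCheck

/-- A function `G : ℝ → ℂ` is *tempered* if it is integrable against some weight `(1 + |x|)⁻ⁿ`
(so it is locally integrable and of polynomial growth in the mean). -/
def IsTempered (G : ℝ → ℂ) : Prop :=
  ∃ n : ℕ, Integrable (fun x : ℝ ↦ G x / (1 + |x| : ℝ) ^ n)

/-- A tempered function remains tempered under the change of variable `ω = 2 π ν`. -/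
theorem IsTempered.comp_two_pi_mul {G : ℝ → ℂ} (hG : IsTempered G) :
    IsTempered (fun ν ↦ G (2 * Real.pi * ν)) := by
  obtain ⟨n, hn⟩ := hG
  have hpi : (1 : ℝ) ≤ 2 * Real.pi := by linarith [Real.pi_gt_three]
  refine ⟨n, ?_⟩
  have h1 := hn.comp_mul_left' (R := 2 * Real.pi) (by positivity)
  have h2 := h1.bdd_mul (c := (2 * Real.pi) ^ n)
    (f := fun ν : ℝ ↦ ((((1 + |2 * Real.pi * ν|) / (1 + |ν|)) ^ n : ℝ) : ℂ))
    (by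
      refine Continuous.aestronglyMeasurable (Complex.continuous_ofReal.comp ?_)
      refine Continuous.pow (Continuous.div (by fun_prop) (by fun_prop) fun x ↦ ?_) n
      positivity)
    (by
      refine Filter.Eventually.of_forall fun ν ↦ ?_
      rw [Complex.norm_real, Real.norm_of_nonneg (by positivity)]
      gcongr
      rw [div_le_iff₀ (by positivity), abs_mul, abs_of_nonneg (by positivity : 0 ≤ 2 * Real.pi)]
      nlinarith [abs_nonneg ν])
  refine h2.congr (Filter.Eventually.of_forall fun ν ↦ ?_)
  have e1 : ((1 + |ν| : ℝ) : ℂ) ≠ 0 := by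
    exact_mod_cast (by positivity : (1 + |ν| : ℝ) ≠ 0)
  have e2 : ((1 + |2 * Real.pi * ν| : ℝ) : ℂ) ≠ 0 := by
    exact_mod_cast (by positivity : (1 + |2 * Real.pi * ν| : ℝ) ≠ 0)
  push_cast at e1 e2 ⊢
  rw [div_pow]
  field_simp

/-- A tempered function times a Schwartz function is integrable, with a seminorm bound. -/
theorem integrable_mul_and_bound {G : ℝ → ℂ} {n : ℕ}
    (hn : Integrable (fun x : ℝ ↦ G x / (1 + |x| : ℝ) ^ n)) (φ : 𝓢(ℝ, ℂ)) :
    Integrable (fun x ↦ G x * φ x) ∧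
      ‖∫ x, G x * φ x‖ ≤ ((∫ x : ℝ, ‖G x / (1 + |x| : ℝ) ^ n‖) * 2 ^ n) *
        (Finset.Iic (n, 0)).sup (schwartzSeminormFamily ℂ ℝ ℂ) φ := by
  set C : ℝ := 2 ^ n * (Finset.Iic (n, 0)).sup (schwartzSeminormFamily ℂ ℝ ℂ) φ with hC
  have hb : ∀ x : ℝ, ‖((1 + |x| : ℝ) : ℂ) ^ n * φ x‖ ≤ C := by
    intro x
    have := SchwartzMap.one_add_le_sup_seminorm_apply (𝕜 := ℂ) (m := (n, 0)) (k := n) (n := 0)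
      le_rfl le_rfl φ x
    rw [norm_iteratedFDeriv_zero, Real.norm_eq_abs] at this
    rw [norm_mul, norm_pow, Complex.norm_real, Real.norm_of_nonneg (by positivity)]
    exact this
  have he : ∀ x : ℝ, G x * φ x =
      ((1 + |x| : ℝ) : ℂ) ^ n * φ x * (G x / (1 + |x| : ℝ) ^ n) := by
    intro x
    have e1 : ((1 + |x| : ℝ) : ℂ) ≠ 0 := by
      exact_mod_cast (by positivity : (1 + |x| : ℝ) ≠ 0)
    push_cast at e1 ⊢
    field_simp
  have hi : Integrable (fun x ↦ G x * φ x) := by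
    simp_rw [he]
    refine hn.bdd_mul (c := C) ?_ (Filter.Eventually.of_forall hb)
    exact Continuous.aestronglyMeasurable (by fun_prop)
  refine ⟨hi, ?_⟩
  calc ‖∫ x, G x * φ x‖ ≤ ∫ x : ℝ, C * ‖G x / (1 + |x| : ℝ) ^ n‖ := by
        refine norm_integral_le_of_norm_le (hn.norm.const_mul C)
          (Filter.Eventually.of_forall fun x ↦ ?_)
        rw [he, norm_mul]
        exact mul_le_mul_of_nonneg_right (hb x) (norm_nonneg _)
    _ = _ := by rw [integral_const_mul, hC]; ring

/-- The tempered distribution `φ ↦ ∫ G(x) φ(x) dx` defined by a tempered function `G`. -/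
def toDistribution (G : ℝ → ℂ) (hG : IsTempered G) : 𝓢'(ℝ, ℂ) :=
  ContinuousLinearMap.toPointwiseConvergenceCLM _ _ _ _ <|
    SchwartzMap.mkCLMtoNormedSpace (𝕜 := ℂ) (σ := RingHom.id ℂ) (fun φ : 𝓢(ℝ, ℂ) ↦ ∫ x, G x * φ x)
      (fun φ ψ ↦ by
        obtain ⟨n, hn⟩ := hG
        simpa [mul_add] using integral_add (integrable_mul_and_bound hn φ).1
          (integrable_mul_and_bound hn ψ).1)
      (fun a φ ↦ by
        simp [← integral_const_mul, mul_left_comm])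
      (by
        obtain ⟨n, hn⟩ := hG
        exact ⟨Finset.Iic (n, 0), (∫ x : ℝ, ‖G x / (1 + |x| : ℝ) ^ n‖) * 2 ^ n, by positivity,
          fun φ ↦ (integrable_mul_and_bound hn φ).2⟩)

/-- The impulse response `h` of a frequency response `ω ↦ H(jω)` (here a function `H` of the real
angular frequency `ω`): its inverse Fourier transform `h(t) = ∫ H(jω) e^{jωt} dω/(2π)`, taken in
the sense of tempered distributions. In the variable `ν = ω/(2π)` this is Mathlib's inverse Fourier
transform `∫ H(2πν) e^{2πjνt} dν`. -/
def impulseResponse (H : ℝ → ℂ) (hH : IsTempered H) : 𝓢'(ℝ, ℂ) :=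
  𝓕⁻ (toDistribution (fun ν ↦ H (2 * Real.pi * ν)) hH.comp_two_pi_mul)

/-- The inverse Fourier integral `∫ H(jω) e^{jωt} dω/(2π)` at the time `t`, for an integrable
frequency response. -/
def inverseFourierIntegral (H : ℝ → ℂ) (t : ℝ) : ℂ :=
  ∫ ω : ℝ, H ω * Complex.exp (Complex.I * ω * t) / (2 * Real.pi)

/-- A frequency response is causal if it has an impulse response (as a tempered distribution), and
this impulse response vanishes for `t < 0`. -/
def IsCausal (H : ℝ → ℂ) : Prop :=
  ∃ hH : IsTempered H, IsVanishingOn (impulseResponse H hH) (Set.Iio 0)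

/-- A filter is minimum phase if it is nonzero at almost every frequency (so that its reciprocal is
a frequency response), and both the filter and its reciprocal are causal. -/
def IsMinimumPhase (F : ℝ → ℂ) : Prop :=
  (∀ᵐ ω : ℝ, F ω ≠ 0) ∧ IsCausal F ∧ IsCausal (fun ω ↦ (F ω)⁻¹)

end CausalityCheck

end

namespace CausalityCheck

open Filter Topology ComplexConjugate

/-! Everything rests on one fact, `IsTemperedCausal.mul`: if `A` and `B` are causal and `A * B` is
tempered, then `A * B` is causal. Applied to `F` and `H` it gives one direction; applied to `1/F`
and `F * H`, whose product is `H` almost everywhere, it gives the other.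

Formally the impulse response of `A * B` is the convolution of two distributions supported on `t ≥
0`. To make this rigorous, powers of the low-pass filter `1/(1 + 2πix)` first reduce to integrable
factors. Such multiplication preserves causality and can be undone, because on test functions it
means solving `ψ - ψ' = φ`, which keeps supports in the negative half-line.

For factors in `L¹ ∩ L²` the claim is Parseval's identity. An integrable factor `A` need not be in
`L²`, so it is damped by the outer function `exp (-c W)`, where `W` is the boundary value of an
analytic function with `Re W = √|A| ≥ 0`. Then `|A exp (-c W)| ≤ √|A| / c` lies in `L²`, causality
survives, and `c → 0` recovers `A` with all products dominated by `|A B|`. -/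

/-! ### Fourier integrals of integrable functions. -/

theorem fourierInv_real_eq_integral (f : ℝ → ℂ) (t : ℝ) :
    𝓕⁻ f t = ∫ x : ℝ, Complex.exp (↑(2 * Real.pi * (x * t)) * Complex.I) * f x := by
  rw [Real.fourierInv_eq']
  simp [mul_comm]

theorem fourier_real_eq_integral (f : ℝ → ℂ) (t : ℝ) :
    𝓕 f t = ∫ x : ℝ, Complex.exp (↑(-2 * Real.pi * (x * t)) * Complex.I) * f x := by
  rw [Real.fourier_eq']
  simp [mul_comm]

theorem norm_exp_mul_eq (a : ℝ) (z : ℂ) : ‖Complex.exp (a * Complex.I) * z‖ = ‖z‖ := by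
  rw [norm_mul, Complex.norm_exp_ofReal_mul_I, one_mul]

theorem integrable_exp_mul {f : ℝ → ℂ} (hf : Integrable f) (t : ℝ) :
    Integrable (fun x : ℝ ↦ Complex.exp (↑(2 * Real.pi * (x * t)) * Complex.I) * f x) := by
  refine hf.bdd_mul (c := 1) ?_ (Eventually.of_forall fun x ↦ ?_)
  · exact Continuous.aestronglyMeasurable (by fun_prop)
  · rw [Complex.norm_exp_ofReal_mul_I]

theorem continuous_fourier_of_integrable {f : ℝ → ℂ} (hf : Integrable f) : Continuous (𝓕 f) :=
  VectorFourier.fourierIntegral_continuous Real.continuous_fourierChar (by fun_prop) hf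

theorem continuous_fourierInv_of_integrable {f : ℝ → ℂ} (hf : Integrable f) :
    Continuous (𝓕⁻ f) := by
  have : 𝓕⁻ f = fun t ↦ 𝓕 f (-t) := by
    ext t; exact Real.fourierInv_eq_fourier_neg f t
  rw [this]
  exact (continuous_fourier_of_integrable hf).comp continuous_neg

theorem norm_fourier_le (f : ℝ → ℂ) (x : ℝ) : ‖𝓕 f x‖ ≤ ∫ s, ‖f s‖ :=
  VectorFourier.norm_fourierIntegral_le_integral_norm _ _ _ _ _

theorem integral_fourier_mul_eq_of_integrable {f g : ℝ → ℂ} (hf : Integrable f)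
    (hg : Integrable g) : ∫ x, 𝓕 f x * g x = ∫ x, f x * 𝓕 g x := by
  have h := VectorFourier.integral_fourierIntegral_smul_eq_flip (L := innerₗ ℝ)
    Real.continuous_fourierChar (by fun_prop) hf hg
  rw [flip_innerₗ] at h
  exact h

theorem integral_fourierInv_mul_eq_of_integrable {f g : ℝ → ℂ} (hf : Integrable f)
    (hg : Integrable g) : ∫ x, 𝓕⁻ f x * g x = ∫ x, f x * 𝓕⁻ g x := by
  rw [Real.fourierInv_eq_fourier_comp_neg, Real.fourierInv_eq_fourier_comp_neg,
    integral_fourier_mul_eq_of_integrable hf.comp_neg hg,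
    ← integral_neg_eq_self (fun x ↦ f x * _)]
  congr 1
  ext x
  congr 1
  rw [← Real.fourierInv_eq_fourier_neg, Real.fourierInv_eq_fourier_comp_neg]
  simp

/-! ### Integrable causal functions and their multipliers. -/

/-- An integrable function whose inverse Fourier integral vanishes at negative times. -/
def IsIntegrableCausal (A : ℝ → ℂ) : Prop :=
  Integrable A ∧ ∀ t < 0, 𝓕⁻ A t = 0

theorem IsIntegrableCausal.of_tendsto {A : ℕ → ℝ → ℂ} {A' : ℝ → ℂ} {bound : ℝ → ℝ}
    (hA : ∀ k, IsIntegrableCausal (A k)) (hb : Integrable bound)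
    (h : ∀ k, ∀ᵐ x, ‖A k x‖ ≤ bound x)
    (hl : ∀ᵐ x, Tendsto (fun k ↦ A k x) atTop (𝓝 (A' x))) : IsIntegrableCausal A' := by
  refine ⟨?_, fun t ht ↦ ?_⟩
  · refine hb.mono' (aestronglyMeasurable_of_tendsto_ae atTop
      (fun k ↦ (hA k).1.aestronglyMeasurable) hl) ?_
    filter_upwards [hl, ae_all_iff.2 h] with x hx hx'
    exact le_of_tendsto hx.norm (Eventually.of_forall hx')
  · have h0 : Tendsto (fun k ↦ 𝓕⁻ (A k) t) atTop (𝓝 (𝓕⁻ A' t)) := by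
      simp_rw [fourierInv_real_eq_integral]
      refine tendsto_integral_of_dominated_convergence bound (fun k ↦ ?_) hb (fun k ↦ ?_) ?_
      · exact (Continuous.aestronglyMeasurable (by fun_prop)).mul (hA k).1.aestronglyMeasurable
      · simpa only [norm_exp_mul_eq] using h k
      · filter_upwards [hl] with x hx
        exact hx.const_mul _
    simp_rw [(hA _).2 t ht] at h0
    exact tendsto_nhds_unique h0 tendsto_const_nhds

theorem IsIntegrableCausal.zero : IsIntegrableCausal (fun _ ↦ 0) :=
  ⟨integrable_zero _ _ _, fun t _ ↦ by simp [fourierInv_real_eq_integral]⟩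

theorem IsIntegrableCausal.add {A B : ℝ → ℂ} (hA : IsIntegrableCausal A)
    (hB : IsIntegrableCausal B) : IsIntegrableCausal (fun x ↦ A x + B x) := by
  refine ⟨hA.1.add hB.1, fun t ht ↦ ?_⟩
  have h1 := hA.2 t ht
  have h2 := hB.2 t ht
  rw [fourierInv_real_eq_integral] at h1 h2 ⊢
  simp_rw [mul_add]
  rw [integral_add (integrable_exp_mul hA.1 t) (integrable_exp_mul hB.1 t), h1, h2, add_zero]

theorem IsIntegrableCausal.const_mul {A : ℝ → ℂ} (hA : IsIntegrableCausal A) (c : ℂ) :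
    IsIntegrableCausal (fun x ↦ c * A x) := by
  refine ⟨hA.1.const_mul c, fun t ht ↦ ?_⟩
  have h1 := hA.2 t ht
  rw [fourierInv_real_eq_integral] at h1 ⊢
  simp_rw [mul_left_comm _ c]
  rw [integral_const_mul, h1, mul_zero]

theorem fourier_exp_mul (f : ℝ → ℂ) (t s : ℝ) :
    𝓕 (fun x : ℝ ↦ Complex.exp (↑(2 * Real.pi * (x * t)) * Complex.I) * f x) s =
      𝓕⁻ f (t - s) := by
  rw [fourier_real_eq_integral, fourierInv_real_eq_integral]
  congr 1
  ext x
  rw [← mul_assoc, ← Complex.exp_add]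
  congr 2
  push_cast
  ring

/-- By the multiplication formula the inverse transform at `t` is the convolution `∫ 𝓕⁻ A (t - s) *
w s`. For `t < 0`, either `s < 0` or `t - s < 0`, so the integrand vanishes. -/
theorem IsIntegrableCausal.mul_fourier {A w : ℝ → ℂ} (hA : IsIntegrableCausal A)
    (hw : Integrable w) (hw0 : ∀ s < 0, w s = 0) :
    IsIntegrableCausal (fun x ↦ A x * 𝓕 w x) := by
  refine ⟨hA.1.mul_bdd (c := ∫ s, ‖w s‖) (continuous_fourier_of_integrable hw).aestronglyMeasurable
    (Eventually.of_forall fun x ↦ norm_fourier_le w x), fun t ht ↦ ?_⟩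
  rw [fourierInv_real_eq_integral]
  simp_rw [← mul_assoc (Complex.exp _)]
  rw [← integral_fourier_mul_eq_of_integrable (integrable_exp_mul hA.1 t) hw, ← integral_zero ℝ ℂ]
  congr 1
  ext s
  rw [fourier_exp_mul]
  rcases lt_or_ge s 0 with hs | hs
  · rw [hw0 s hs, mul_zero]
  · rw [hA.2 _ (by linarith), zero_mul]

/-- The partial sums of the exponential series are covered by `mul_fourier`; they are dominated
because `𝓕 w` is bounded by the `L¹` norm of `w`. -/
theorem IsIntegrableCausal.mul_exp_fourier {A w : ℝ → ℂ} (hA : IsIntegrableCausal A)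
    (hw : Integrable w) (hw0 : ∀ s < 0, w s = 0) (c : ℂ) :
    IsIntegrableCausal (fun x ↦ A x * Complex.exp (c * 𝓕 w x)) := by
  have hpow : ∀ n : ℕ, IsIntegrableCausal (fun x ↦ A x * 𝓕 w x ^ n) := by
    intro n
    induction n with
    | zero => simpa using hA
    | succ n ih => simpa only [pow_succ, ← mul_assoc] using ih.mul_fourier hw hw0
  have hsum : ∀ n : ℕ, IsIntegrableCausal
      (fun x ↦ A x * ∑ m ∈ Finset.range n, (c * 𝓕 w x) ^ m / m.factorial) := by
    intro n
    induction n with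
    | zero => simpa using IsIntegrableCausal.zero
    | succ n ih =>
      convert ih.add ((hpow n).const_mul (c ^ n / n.factorial)) using 2 with x
      rw [Finset.sum_range_succ, mul_pow]
      ring
  refine IsIntegrableCausal.of_tendsto hsum
    (hA.1.norm.mul_const (Real.exp (‖c‖ * ∫ s, ‖w s‖))) (fun n ↦ Eventually.of_forall fun x ↦ ?_)
    (Eventually.of_forall fun x ↦ ?_)
  · rw [norm_mul]
    gcongr
    calc _ ≤ ∑ m ∈ Finset.range n, ‖(c * 𝓕 w x) ^ m / (m.factorial : ℂ)‖ := norm_sum_le _ _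
      _ = ∑ m ∈ Finset.range n, (‖c‖ * ‖𝓕 w x‖) ^ m / m.factorial := by
          simp [mul_pow]
      _ ≤ Real.exp (‖c‖ * ‖𝓕 w x‖) := Real.sum_le_exp_of_nonneg (by positivity) n
      _ ≤ _ := by
          gcongr
          exact norm_fourier_le w x
  · refine Tendsto.const_mul _ ?_
    rw [Complex.exp_eq_exp_ℂ]
    exact (NormedSpace.expSeries_div_hasSum_exp (c * 𝓕 w x)).tendsto_sum_nat

/-! ### Plancherel theory and products in `L¹ ∩ L²`. -/

theorem ae_eq_of_integral_schwartz_mul_eq {f g : ℝ → ℂ} (hf : LocallyIntegrable f)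
    (hg : LocallyIntegrable g) (h : ∀ φ : 𝓢(ℝ, ℂ), ∫ x, φ x * f x = ∫ x, φ x * g x) :
    f =ᵐ[volume] g := by
  refine ae_eq_of_integral_contDiff_smul_eq hf hg fun χ h1 h2 ↦ ?_
  have hc : HasCompactSupport (Complex.ofRealCLM ∘ χ) := h2.comp_left rfl
  have := h (hc.toSchwartzMap (Complex.ofRealCLM.contDiff.comp h1))
  simp only [Complex.real_smul]
  exact this

theorem coeFn_fourier_toLp {f : ℝ → ℂ} (h1 : Integrable f) (h2 : MemLp f 2) :
    ((𝓕 (h2.toLp f) : Lp ℂ 2 (volume : Measure ℝ)) : ℝ → ℂ) =ᵐ[volume] 𝓕 f := by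
  refine ae_eq_of_integral_schwartz_mul_eq ((Lp.memLp _).locallyIntegrable (by norm_num))
    (continuous_fourier_of_integrable h1).locallyIntegrable fun φ ↦ ?_
  have h := congrArg (fun T : 𝓢'(ℝ, ℂ) ↦ T φ) (Lp.fourier_toTemperedDistribution_eq (h2.toLp f))
  simp only [TemperedDistribution.fourier_apply, Lp.toTemperedDistribution_apply,
    smul_eq_mul] at h
  rw [← h, ← integral_fourier_mul_eq_of_integrable φ.integrable h1]
  refine integral_congr_ae ?_
  filter_upwards [h2.coeFn_toLp] with x hx
  rw [hx]
  rfl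

theorem coeFn_fourierInv_toLp {f : ℝ → ℂ} (h1 : Integrable f) (h2 : MemLp f 2) :
    ((𝓕⁻ (h2.toLp f) : Lp ℂ 2 (volume : Measure ℝ)) : ℝ → ℂ) =ᵐ[volume] 𝓕⁻ f := by
  refine ae_eq_of_integral_schwartz_mul_eq ((Lp.memLp _).locallyIntegrable (by norm_num))
    (continuous_fourierInv_of_integrable h1).locallyIntegrable fun φ ↦ ?_
  have h := congrArg (fun T : 𝓢'(ℝ, ℂ) ↦ T φ)
    (Lp.fourierInv_toTemperedDistribution_eq (h2.toLp f))
  simp only [TemperedDistribution.fourierInv_apply, Lp.toTemperedDistribution_apply,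
    smul_eq_mul] at h
  rw [← h, ← integral_fourierInv_mul_eq_of_integrable φ.integrable h1]
  refine integral_congr_ae ?_
  filter_upwards [h2.coeFn_toLp] with x hx
  rw [hx, SchwartzMap.fourierInv_coe]

theorem fourier_conj (f : ℝ → ℂ) (s : ℝ) : 𝓕 (fun x ↦ conj (f x)) s = conj (𝓕⁻ f s) := by
  rw [fourier_real_eq_integral, fourierInv_real_eq_integral, ← integral_conj]
  congr 1
  ext x
  rw [map_mul, ← Complex.exp_conj, map_mul, Complex.conj_I, Complex.conj_ofReal]
  congr 2
  push_cast
  ring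

theorem tendsto_toLp_two_of_dominated {f : ℕ → ℝ → ℂ} {v : ℝ → ℂ} {b : ℝ → ℝ} (hb : MemLp b 2)
    (hf : ∀ k, MemLp (f k) 2) (hv : MemLp v 2) (hle : ∀ k, ∀ᵐ x, ‖f k x‖ ≤ b x)
    (hlim : ∀ᵐ x, Tendsto (fun k ↦ f k x) atTop (𝓝 (v x))) :
    Tendsto (fun k ↦ (hf k).toLp (f k)) atTop (𝓝 (hv.toLp v)) := by
  rw [Lp.tendsto_Lp_iff_tendsto_eLpNorm'']
  have hvb : ∀ᵐ x, ‖v x‖ ≤ b x := by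
    filter_upwards [hlim, ae_all_iff.2 hle] with x hx hx'
    exact le_of_tendsto hx.norm (Eventually.of_forall hx')
  have key : Tendsto (fun k ↦ ∫⁻ x, ‖(f k - v) x‖ₑ ^ (2 : ℝ)) atTop (𝓝 (∫⁻ x : ℝ, 0)) := by
    refine tendsto_lintegral_of_dominated_convergence' (fun x ↦ ‖2 * b x‖ₑ ^ (2 : ℝ))
      (fun k ↦ (((hf k).sub hv).aestronglyMeasurable.enorm).pow_const _) (fun k ↦ ?_) ?_ ?_
    · filter_upwards [hle k, hvb] with x h1 h2
      gcongr
      rw [enorm_le_iff_norm_le]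
      calc ‖f k x - v x‖ ≤ ‖f k x‖ + ‖v x‖ := norm_sub_le _ _
        _ ≤ 2 * b x := by linarith
        _ ≤ ‖2 * b x‖ := Real.le_norm_self _
    · simpa using (lintegral_rpow_enorm_lt_top_of_eLpNorm_lt_top (by norm_num) (by norm_num)
        (hb.const_mul 2).eLpNorm_lt_top).ne
    · filter_upwards [hlim] with x hx
      have h0 : Tendsto (fun k ↦ ‖(f k - v) x‖ₑ) atTop (𝓝 0) := by
        simpa using (hx.sub_const (v x)).enorm
      have := (ENNReal.continuous_rpow_const (y := 2)).tendsto 0 |>.comp h0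
      rwa [ENNReal.zero_rpow_of_pos two_pos] at this
  simp_rw [eLpNorm_eq_lintegral_rpow_enorm_toReal two_ne_zero ENNReal.ofNat_ne_top]
  have := (ENNReal.continuous_rpow_const (y := (1 / 2 : ℝ))).tendsto (∫⁻ x : ℝ, 0) |>.comp key
  rw [lintegral_zero, ENNReal.zero_rpow_of_pos (by norm_num)] at this
  exact this

/-- Domination gives `L²` convergence, which the Fourier isometry preserves; `L²` convergence
implies convergence in measure, hence almost everywhere along a subsequence. -/
theorem exists_subseq_fourier_tendsto_ae {f : ℕ → ℝ → ℂ} {v : ℝ → ℂ} {b : ℝ → ℝ} (hb : MemLp b 2)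
    (hf : ∀ k, Integrable (f k)) (hv : MemLp v 2) (hle : ∀ k, ∀ᵐ x, ‖f k x‖ ≤ b x)
    (hlim : ∀ᵐ x, Tendsto (fun k ↦ f k x) atTop (𝓝 (v x))) :
    ∃ ψ : ℕ → ℕ, StrictMono ψ ∧ ∀ᵐ x, Tendsto (fun k ↦ 𝓕 (f (ψ k)) x) atTop
      (𝓝 ((𝓕 (hv.toLp v) : Lp ℂ 2 (volume : Measure ℝ)) x)) := by
  have hf2 : ∀ k, MemLp (f k) 2 := fun k ↦
    hb.mono (hf k).aestronglyMeasurable (by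
      filter_upwards [hle k] with x hx using hx.trans (Real.le_norm_self _))
  have h1 := ((Lp.fourierTransformₗᵢ ℝ ℂ).continuous.tendsto (hv.toLp v)).comp
    (tendsto_toLp_two_of_dominated hb hf2 hv hle hlim)
  obtain ⟨ψ, hψ, h⟩ := (tendstoInMeasure_of_tendsto_Lp h1).exists_seq_tendsto_ae
  refine ⟨ψ, hψ, ?_⟩
  filter_upwards [h, ae_all_iff.2 fun k ↦ coeFn_fourier_toLp (hf k) (hf2 k)] with x hx hx'
  refine hx.congr fun k ↦ ?_
  exact hx' (ψ k)

theorem IsIntegrableCausal.mul {A B : ℝ → ℂ} (hA : IsIntegrableCausal A)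
    (hB : IsIntegrableCausal B) (hA2 : MemLp A 2) (hB2 : MemLp B 2) :
    IsIntegrableCausal (fun x ↦ A x * B x) := by
  refine ⟨hA2.integrable_mul hB2, fun t ht ↦ ?_⟩
  set f : ℝ → ℂ := fun x ↦ Complex.exp (↑(2 * Real.pi * (x * t)) * Complex.I) * A x with hf
  have hf1 : Integrable f := integrable_exp_mul hA.1 t
  have hf2 : MemLp f 2 := hA2.of_le hf1.aestronglyMeasurable
    (Eventually.of_forall fun x ↦ (norm_exp_mul_eq _ _).le)
  have hc1 : Integrable (fun x ↦ conj (f x)) := by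
    simpa using (RCLike.conjCLE (K := ℂ)).toContinuousLinearMap.integrable_comp hf1
  have hc2 : MemLp (fun x ↦ conj (f x)) 2 := hf2.of_le hc1.aestronglyMeasurable
    (Eventually.of_forall fun x ↦ by simp)
  -- The inner product conjugates its first argument, so `conj f` turns Parseval into an identity
  -- for `∫ f * B`. On the Fourier side the integrand is `𝓕⁻ A (t + s) * 𝓕⁻ B (-s)`, and for `t < 0`
  -- one of the two times is negative.
  have h := Lp.inner_fourier_eq (hc2.toLp _) (hB2.toLp _)
  rw [L2.inner_def, L2.inner_def] at h
  have hR : ∫ x, inner ℂ ((hc2.toLp _ : Lp ℂ 2 (volume : Measure ℝ)) x)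
      ((hB2.toLp _ : Lp ℂ 2 (volume : Measure ℝ)) x) = 𝓕⁻ (fun x ↦ A x * B x) t := by
    rw [fourierInv_real_eq_integral]
    refine integral_congr_ae ?_
    filter_upwards [hc2.coeFn_toLp, hB2.coeFn_toLp] with x h1 h2
    rw [h1, h2]
    simp only [RCLike.inner_apply, hf, Complex.conj_conj]
    ring
  rw [← hR, ← h]
  refine integral_eq_zero_of_ae ?_
  filter_upwards [coeFn_fourier_toLp hc1 hc2, coeFn_fourier_toLp hB.1 hB2] with s h1 h2
  rw [h1, h2, fourier_conj, Real.fourierInv_eq_fourier_neg, hf, fourier_exp_mul]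
  simp only [RCLike.inner_apply, Complex.conj_conj, Pi.zero_apply]
  rcases lt_or_ge 0 s with hs | hs
  · have := hB.2 (-s) (by linarith)
    rw [Real.fourierInv_eq_fourier_neg, neg_neg] at this
    rw [this, zero_mul]
  · rcases lt_or_ge (t - -s) 0 with hs' | hs'
    · rw [hA.2 _ hs', mul_zero]
    · linarith

/-! ### Analytic completion of a nonnegative function. -/

/-- The transform equals `∫ 𝓕⁻ h (y - x) * u y`, an average of `u ≥ 0` against a kernel with
nonnegative real part, as in a Poisson integral. -/
theorem re_fourier_mul_nonneg {u h : ℝ → ℂ} (hu : Integrable u) (hh : Integrable h)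
    (hu0 : ∀ x, 0 ≤ (u x).re) (hui : ∀ x, (u x).im = 0) (hre : ∀ x, 0 ≤ (𝓕⁻ h x).re) (x : ℝ) :
    0 ≤ (𝓕 (fun s ↦ h s * 𝓕⁻ u s) x).re := by
  have e1 : 𝓕 (fun s ↦ h s * 𝓕⁻ u s) x = ∫ y, 𝓕⁻ h (y - x) * u y := by
    have hi := integrable_exp_mul hh (-x)
    have := integral_fourierInv_mul_eq_of_integrable hi hu
    rw [fourier_real_eq_integral]
    calc _ = _ := ?_
      _ = _ := this.symm
      _ = _ := ?_
    · congr 1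
      ext s
      rw [← mul_assoc]
      congr 4
      push_cast
      ring
    · congr 1
      ext y
      rw [Real.fourierInv_eq_fourier_neg, fourier_exp_mul]
      congr 2
      ring_nf
  have hint : Integrable (fun y ↦ 𝓕⁻ h (y - x) * u y) := by
    refine hu.bdd_mul (c := ∫ s, ‖h s‖) ?_ (Eventually.of_forall fun y ↦ ?_)
    · exact ((continuous_fourierInv_of_integrable hh).comp
        (continuous_sub_right x)).aestronglyMeasurable
    · rw [Real.fourierInv_eq_fourier_neg]
      exact norm_fourier_le _ _
  rw [e1, ← RCLike.re_to_complex, ← integral_re hint]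
  refine integral_nonneg fun y ↦ ?_
  simp only [RCLike.re_to_complex, Complex.mul_re, hui, mul_zero, sub_zero]
  exact mul_nonneg (hre _) (hu0 _)

theorem integrable_indicator_exp {ε : ℝ} (hε : 0 < ε) :
    Integrable (Set.indicator (Set.Ioi (0 : ℝ)) fun s ↦ (2 * Real.exp (-ε * s) : ℂ)) := by
  rw [integrable_indicator_iff measurableSet_Ioi]
  refine Integrable.const_mul ?_ 2
  simpa using (integrableOn_exp_mul_Ioi (neg_lt_zero.2 hε) 0).ofReal (𝕜 := ℂ)

/-- The transform is `2 / (ε - 2πix)`, whose real part is a Poisson kernel. -/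
theorem fourierInv_indicator_exp_re_nonneg {ε : ℝ} (hε : 0 < ε) (x : ℝ) :
    0 ≤ (𝓕⁻ (Set.indicator (Set.Ioi (0 : ℝ)) fun s ↦ (2 * Real.exp (-ε * s) : ℂ)) x).re := by
  have e : 𝓕⁻ (Set.indicator (Set.Ioi (0 : ℝ)) fun s ↦ (2 * Real.exp (-ε * s) : ℂ)) x =
      2 * ∫ s in Set.Ioi (0 : ℝ), Complex.exp ((-ε + 2 * Real.pi * x * Complex.I) * s) := by
    rw [fourierInv_real_eq_integral, ← integral_const_mul, ← integral_indicator measurableSet_Ioi]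
    congr 1
    ext s
    by_cases hs : s ∈ Set.Ioi (0 : ℝ)
    · rw [Set.indicator_of_mem hs, Set.indicator_of_mem hs]
      push_cast
      rw [mul_left_comm, ← Complex.exp_add]
      congr 2
      ring
    · simp [Set.indicator_of_notMem hs]
  rw [e, integral_exp_mul_complex_Ioi (by simpa using hε)]
  simp only [Complex.ofReal_zero, mul_zero, Complex.exp_zero]
  rw [Complex.mul_re, Complex.div_re]
  simpa using div_nonneg hε.le (Complex.normSq_nonneg _)

/-- A nonnegative function in `L¹ ∩ L²` is the real part of the boundary value of a function that is
analytic with positive real part in a half-plane, approximated here by Fourier transforms of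
integrable functions supported on the nonnegative half-line. -/
theorem exists_analytic_completion {u : ℝ → ℝ} (hu0 : ∀ x, 0 ≤ u x) (h1 : Integrable u)
    (h2 : MemLp u 2) :
    ∃ (w : ℕ → ℝ → ℂ) (W : ℝ → ℂ), (∀ k, Integrable (w k)) ∧ (∀ k, ∀ s < 0, w k s = 0) ∧
      (∀ k x, 0 ≤ (𝓕 (w k) x).re) ∧ (∀ᵐ x, Tendsto (fun k ↦ 𝓕 (w k) x) atTop (𝓝 (W x))) ∧
      ∀ᵐ x, (W x).re = u x := by
  set U : ℝ → ℂ := fun x ↦ (u x : ℂ) with hU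
  have hU1 : Integrable U := h1.ofReal
  have hU2 : MemLp U 2 := h2.ofReal
  set v : ℝ → ℂ := 𝓕⁻ U with hv
  have hvae := coeFn_fourierInv_toLp hU1 hU2
  have hv2 : MemLp v 2 := (memLp_congr_ae hvae).1 (Lp.memLp _)
  have hvLp : hv2.toLp v = 𝓕⁻ (hU2.toLp U) := by
    rw [← Lp.toLp_coeFn (𝓕⁻ (hU2.toLp U)) (Lp.memLp _)]
    exact (MemLp.toLp_eq_toLp_iff _ _).2 hvae.symm
  have hvcont : Continuous v := continuous_fourierInv_of_integrable hU1
  have hvbd : ∀ s, ‖v s‖ ≤ ∫ x, ‖U x‖ := fun s ↦ by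
    rw [hv, Real.fourierInv_eq_fourier_neg]; exact norm_fourier_le _ _
  have hvconj : ∀ s, conj (v (-s)) = v s := fun s ↦ by
    rw [hv, ← fourier_conj, Real.fourierInv_eq_fourier_neg]
    simp [hU]
  have hε : ∀ k : ℕ, (0 : ℝ) < 1 / ((k : ℝ) + 1) := fun k ↦ by positivity
  -- Since `u` is real, `v (-s) = conj (v s)`, so `u` is formally the real part of the transform of
  -- `2 v` cut off to `s > 0`. The exponential makes this integrable and is removed as `k → ∞`.
  set e : ℕ → ℝ → ℂ := fun k ↦
    Set.indicator (Set.Ioi 0) fun s ↦ (2 * Real.exp (-(1 / ((k : ℝ) + 1)) * s) : ℂ) with he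
  set w : ℕ → ℝ → ℂ := fun k s ↦ e k s * v s with hw
  have he1 : ∀ k, Integrable (e k) := fun k ↦ integrable_indicator_exp (hε k)
  have hw1 : ∀ k, Integrable (w k) := fun k ↦
    (he1 k).mul_bdd hvcont.aestronglyMeasurable (Eventually.of_forall hvbd)
  have hebd : ∀ k s, ‖e k s‖ ≤ 2 := fun k s ↦ by
    by_cases hs : s ∈ Set.Ioi (0 : ℝ)
    · rw [he]
      simp only [Set.indicator_of_mem hs]
      rw [norm_mul, Complex.norm_real, Real.norm_of_nonneg (Real.exp_nonneg _)]
      have : Real.exp (-(1 / ((k : ℝ) + 1)) * s) ≤ 1 := by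
        rw [Real.exp_le_one_iff]
        have := mul_nonneg (hε k).le (le_of_lt hs)
        linarith
      simpa using this
    · simp [he, Set.indicator_of_notMem hs]
  have helim : ∀ s, Tendsto (fun k ↦ e k s) atTop
      (𝓝 (Set.indicator (Set.Ioi (0 : ℝ)) (fun _ ↦ (2 : ℂ)) s)) := fun s ↦ by
    by_cases hs : s ∈ Set.Ioi (0 : ℝ)
    · simp only [he, Set.indicator_of_mem hs]
      have hc : Continuous fun y : ℝ ↦ (2 * Real.exp (-y * s) : ℂ) := by fun_prop
      have := (hc.tendsto 0).comp (tendsto_one_div_add_atTop_nhds_zero_nat (𝕜 := ℝ))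
      rwa [neg_zero, zero_mul, Real.exp_zero, Complex.ofReal_one, mul_one] at this
    · simp only [he, Set.indicator_of_notMem hs]
      exact tendsto_const_nhds
  -- The bound must serve both `w k`, where 2 suffices, and its Hermitian symmetrization below,
  -- where two such terms add up to 4.
  have hb : MemLp (fun s ↦ 4 * ‖v s‖) 2 := hv2.norm.const_mul 4
  have hv' : MemLp (fun s ↦ Set.indicator (Set.Ioi (0 : ℝ)) (fun _ ↦ (2 : ℂ)) s * v s) 2 := by
    have := (hv2.const_mul 2).indicator (measurableSet_Ioi (a := (0 : ℝ)))
    refine this.congr_norm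
      ((measurable_const.indicator measurableSet_Ioi).aestronglyMeasurable.mul
        hvcont.aestronglyMeasurable) (Eventually.of_forall fun s ↦ ?_)
    rw [Set.indicator_mul_left]
  obtain ⟨ψ, hψ, hψlim⟩ := exists_subseq_fourier_tendsto_ae hb hw1 hv'
    (fun k ↦ Eventually.of_forall fun s ↦ by
      rw [norm_mul]
      have := hebd k s
      nlinarith [norm_nonneg (v s)])
    (Eventually.of_forall fun s ↦ (helim s).mul_const _)
  -- The transform of `g k` is `2 Re 𝓕 (w k)`, while `g k → 2 v` off `0`. This identifies the real
  -- part of the limit as `u`.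
  set g : ℕ → ℝ → ℂ := fun k s ↦ w k s + conj (w k (-s)) with hg
  have hconj1 : ∀ k, Integrable (fun s ↦ conj (w k (-s))) := fun k ↦ by
    simpa using (RCLike.conjCLE (K := ℂ)).toContinuousLinearMap.integrable_comp (hw1 k).comp_neg
  have hgF : ∀ k x, 𝓕 (g k) x = ((2 * (𝓕 (w k) x).re : ℝ) : ℂ) := fun k x ↦ by
    have ha : 𝓕 (g k) x = 𝓕 (w k) x + 𝓕 (fun s ↦ conj (w k (-s))) x := by
      rw [fourier_real_eq_integral, fourier_real_eq_integral, fourier_real_eq_integral,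
        ← integral_add]
      · simp only [hg, mul_add]
      · simpa using integrable_exp_mul (hw1 k) (-x)
      · simpa using integrable_exp_mul (hconj1 k) (-x)
    rw [ha, fourier_conj, Real.fourierInv_eq_fourier_comp_neg]
    simp only [neg_neg]
    rw [Complex.add_conj]
  have hg1 : ∀ k, Integrable (g k) := fun k ↦ (hw1 k).add (hconj1 k)
  have hgeq : ∀ k s, g k s = (e k s + conj (e k (-s))) * v s := fun k s ↦ by
    simp only [hg, hw, map_mul, hvconj]
    ring
  have hv2' : MemLp (fun s ↦ 2 * v s) 2 := hv2.const_mul 2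
  obtain ⟨θ, hθ, hθlim⟩ := exists_subseq_fourier_tendsto_ae (f := fun k ↦ g (ψ k)) hb
    (fun k ↦ hg1 _) hv2'
    (fun k ↦ Eventually.of_forall fun s ↦ by
      rw [hgeq, norm_mul]
      gcongr
      refine (norm_add_le _ _).trans ?_
      rw [RCLike.norm_conj]
      linarith [hebd (ψ k) s, hebd (ψ k) (-s)])
    (by
      filter_upwards [Measure.ae_ne volume (0 : ℝ)] with s hs
      simp_rw [hgeq]
      refine Tendsto.mul_const _ ?_
      have h1 := ((helim s).add ((Complex.continuous_conj.tendsto _).comp (helim (-s)))).comp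
        hψ.tendsto_atTop
      have h2 : Set.indicator (Set.Ioi (0 : ℝ)) (fun _ ↦ (2 : ℂ)) s +
          conj (Set.indicator (Set.Ioi (0 : ℝ)) (fun _ ↦ (2 : ℂ)) (-s)) = 2 := by
        rcases lt_or_gt_of_ne hs with h | h
        · simp [Set.indicator, h, h.not_gt, map_ofNat]
        · simp [Set.indicator, h, h.not_gt]
      rw [h2] at h1
      exact h1)
  refine ⟨fun k ↦ w (ψ (θ k)), (𝓕 (hv'.toLp _) : Lp ℂ 2 (volume : Measure ℝ)), fun k ↦ hw1 _,
    fun k s hs ↦ ?_, fun k x ↦ ?_, ?_, ?_⟩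
  · simp [hw, he, Set.indicator_of_notMem (show s ∉ Set.Ioi (0 : ℝ) by simpa using hs.le)]
  · exact re_fourier_mul_nonneg hU1 (he1 _) (fun x ↦ by simpa [hU] using hu0 x)
      (fun x ↦ by simp [hU]) (fourierInv_indicator_exp_re_nonneg (hε _)) x
  · filter_upwards [hψlim] with x hx using hx.comp hθ.tendsto_atTop
  · have hlp : 𝓕 (hv2'.toLp (fun s ↦ 2 * v s)) = (2 : ℂ) • hU2.toLp U := by
      have : hv2'.toLp (fun s ↦ 2 * v s) = (2 : ℂ) • hv2.toLp v :=
        MemLp.toLp_const_smul (2 : ℂ) hv2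
      rw [this, FourierTransform.fourier_smul, hvLp, FourierTransform.fourier_fourierInv_eq]
    rw [hlp] at hθlim
    filter_upwards [hψlim, hθlim, Lp.coeFn_smul (2 : ℂ) (hU2.toLp U), hU2.coeFn_toLp]
      with x hx1 hx2 hx3 hx4
    rw [hx3, Pi.smul_apply, hx4] at hx2
    simp_rw [hgF] at hx2
    have h3 := (Complex.continuous_re.tendsto _).comp hx2
    have h4 := ((Complex.continuous_re.tendsto _).comp (hx1.comp hθ.tendsto_atTop)).const_mul 2
    have := tendsto_nhds_unique h4 (h3.congr fun k ↦ by simp)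
    simp [hU] at this
    exact this

/-! ### Outer damping and products of integrable causal functions. -/

/-- The multipliers are `exp (-W / (n + 1))` with `Re W = √‖A‖`. They have modulus at most 1, tend
to 1, and decay fast enough where `A` is large to bring the product into `L²`. -/
theorem IsIntegrableCausal.exists_bounded_approx {A : ℝ → ℂ} (hA : IsIntegrableCausal A)
    (hs : Integrable fun x ↦ √‖A x‖) :
    ∃ g : ℕ → ℝ → ℂ, (∀ n x, ‖g n x‖ ≤ 1) ∧
      (∀ᵐ x, Tendsto (fun n ↦ g n x) atTop (𝓝 1)) ∧
      ∀ n, IsIntegrableCausal (fun x ↦ A x * g n x) ∧ MemLp (fun x ↦ A x * g n x) 2 := by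
  have hs2 : MemLp (fun x ↦ √‖A x‖) 2 := by
    rw [memLp_two_iff_integrable_sq hs.aestronglyMeasurable]
    simpa [Real.sq_sqrt] using hA.1.norm
  obtain ⟨w, W, hw, hw0, hre, hlim, hWre⟩ :=
    exists_analytic_completion (fun x ↦ Real.sqrt_nonneg ‖A x‖) hs hs2
  set c : ℕ → ℝ := fun n ↦ 1 / ((n : ℝ) + 1) with hc
  have hc0 : ∀ n, 0 < c n := fun n ↦ by positivity
  -- The value 1 on the null set where `Re W < 0` makes the bound hold everywhere.
  set g : ℕ → ℝ → ℂ := fun n x ↦ if 0 ≤ (W x).re then Complex.exp (-c n * W x) else 1 with hg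
  have hgae : ∀ᵐ x, ∀ n, g n x = Complex.exp (-c n * W x) := by
    filter_upwards [hWre] with x hx n
    rw [hg]
    simp [hx]
  have hcaus : ∀ n, IsIntegrableCausal (fun x ↦ A x * g n x) := fun n ↦ by
    refine IsIntegrableCausal.of_tendsto (fun k ↦ hA.mul_exp_fourier (hw k) (hw0 k) (-c n))
      hA.1.norm (fun k ↦ Eventually.of_forall fun x ↦ ?_) ?_
    · rw [norm_mul, Complex.norm_exp]
      refine mul_le_of_le_one_right (norm_nonneg _) (Real.exp_le_one_iff.2 ?_)
      have := mul_nonneg (hc0 n).le (hre k x)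
      simpa using this
    · filter_upwards [hlim, hgae] with x hx hx'
      rw [hx']
      exact (((Complex.continuous_exp.tendsto _).comp (hx.const_mul _)).const_mul _)
  refine ⟨g, fun n x ↦ ?_, ?_, fun n ↦ ⟨hcaus n, ?_⟩⟩
  · simp only [hg]
    split_ifs with h
    · rw [Complex.norm_exp, Real.exp_le_one_iff]
      have := mul_nonneg (hc0 n).le h
      simpa using this
    · simp
  · filter_upwards [hgae] with x hx
    simp_rw [hx]
    have hcont : Continuous fun y : ℝ ↦ Complex.exp (-y * W x) := by fun_prop
    have := (hcont.tendsto 0).comp (tendsto_one_div_add_atTop_nhds_zero_nat (𝕜 := ℝ))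
    rwa [Complex.ofReal_zero, neg_zero, zero_mul, Complex.exp_zero] at this
  -- With `y = √‖A x‖`, the inequality `c y exp (-c y) ≤ 1` gives `y² exp (-c y) ≤ y / c`; the
  -- factor 4 is slack.
  · refine (hs2.const_mul (4 * (1 / c n))).of_le (hcaus n).1.aestronglyMeasurable ?_
    filter_upwards [hgae, hWre] with x hx hx'
    rw [hx, norm_mul, Complex.norm_exp]
    have e1 : (-(c n : ℂ) * W x).re = -(c n * √‖A x‖) := by simp [hx']
    rw [e1]
    set y := √‖A x‖ with hy
    have hy0 : 0 ≤ y := Real.sqrt_nonneg _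
    have e2 : ‖A x‖ = y * y := (Real.mul_self_sqrt (norm_nonneg _)).symm
    have e3 : c n * y * Real.exp (-(c n * y)) ≤ 1 := by
      rw [Real.exp_neg, mul_inv_le_iff₀ (Real.exp_pos _), one_mul]
      linarith [Real.add_one_le_exp (c n * y)]
    refine le_trans ?_ (Real.le_norm_self _)
    have hcn := hc0 n
    calc ‖A x‖ * Real.exp (-(c n * y)) = (c n * y * Real.exp (-(c n * y))) * (1 / c n * y) := by
          rw [e2]; field_simp
      _ ≤ 1 * (1 / c n * y) := by gcongr
      _ ≤ 4 * (1 / c n) * y := by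
          have : 0 ≤ 1 / c n * y := by positivity
          linarith

theorem IsIntegrableCausal.mul_of_integrable {A B : ℝ → ℂ} (hA : IsIntegrableCausal A)
    (hB : IsIntegrableCausal B) (hAs : Integrable fun x ↦ √‖A x‖)
    (hBs : Integrable fun x ↦ √‖B x‖) (hAB : Integrable fun x ↦ A x * B x) :
    IsIntegrableCausal (fun x ↦ A x * B x) := by
  obtain ⟨g, hg1, hglim, hgA⟩ := hA.exists_bounded_approx hAs
  obtain ⟨h, hh1, hhlim, hhB⟩ := hB.exists_bounded_approx hBs
  refine IsIntegrableCausal.of_tendsto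
    (fun n ↦ (hgA n).1.mul (hhB n).1 (hgA n).2 (hhB n).2) hAB.norm
    (fun n ↦ Eventually.of_forall fun x ↦ ?_) ?_
  · calc _ = ‖A x * B x‖ * (‖g n x‖ * ‖h n x‖) := by simp only [norm_mul]; ring
      _ ≤ ‖A x * B x‖ * (1 * 1) := by
        gcongr
        · exact hg1 n x
        · exact hh1 n x
      _ = _ := by ring
  · filter_upwards [hglim, hhlim] with x hx hx'
    simpa using (hx.const_mul (A x)).mul (hx'.const_mul (B x))

/-! ### Causality of tempered functions. -/

/-- A tempered function annihilating the inverse Fourier transforms of all Schwartz functions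
supported in the negative half-line. -/
def IsTemperedCausal (A : ℝ → ℂ) : Prop :=
  IsTempered A ∧ ∀ φ : 𝓢(ℝ, ℂ), tsupport φ ⊆ Set.Iio 0 → ∫ x, A x * 𝓕⁻ φ x = 0

theorem isVanishingOn_impulseResponse_iff {H : ℝ → ℂ} (hH : IsTempered H) :
    IsVanishingOn (impulseResponse H hH) (Set.Iio 0) ↔
      IsTemperedCausal fun ν ↦ H (2 * Real.pi * ν) :=
  ⟨fun h ↦ ⟨hH.comp_two_pi_mul, h⟩, fun h ↦ h.2⟩

theorem IsTemperedCausal.congr {A B : ℝ → ℂ} (hA : IsTemperedCausal A) (h : A =ᵐ[volume] B) :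
    IsTemperedCausal B := by
  obtain ⟨⟨n, hn⟩, hA'⟩ := hA
  refine ⟨⟨n, hn.congr ?_⟩, fun φ hφ ↦ ?_⟩
  · filter_upwards [h] with x hx
    rw [hx]
  · rw [← hA' φ hφ]
    refine integral_congr_ae ?_
    filter_upwards [h] with x hx
    rw [hx]

theorem isTempered_of_integrable {A : ℝ → ℂ} (hA : Integrable A) : IsTempered A :=
  ⟨0, by simpa using hA⟩

/-- Duality moves `𝓕⁻` onto `A`. Since `𝓕⁻ A` is continuous, vanishing as a distribution on the open
half-line is vanishing at every point of it. -/
theorem isTemperedCausal_iff_of_integrable {A : ℝ → ℂ} (hA : Integrable A) :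
    IsTemperedCausal A ↔ ∀ t < 0, 𝓕⁻ A t = 0 := by
  have key : ∀ φ : 𝓢(ℝ, ℂ), ∫ x, A x * 𝓕⁻ φ x = ∫ t, φ t * 𝓕⁻ A t := fun φ ↦ by
    have := integral_fourierInv_mul_eq_of_integrable φ.integrable hA
    rw [← this, SchwartzMap.fourierInv_coe]
    simp_rw [mul_comm]
  constructor
  · intro h
    have hcont := continuous_fourierInv_of_integrable hA
    have h1 : ∀ᵐ t, t ∈ Set.Iio (0 : ℝ) → 𝓕⁻ A t = 0 := by
      refine isOpen_Iio.ae_eq_zero_of_integral_contDiff_smul_eq_zero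
        (hcont.locallyIntegrable.locallyIntegrableOn _) fun χ h1 h2 h3 ↦ ?_
      have hc : HasCompactSupport (Complex.ofRealCLM ∘ χ) := h2.comp_left rfl
      have hsub : tsupport (Complex.ofRealCLM ∘ χ) ⊆ Set.Iio 0 :=
        (closure_mono (Function.support_comp_subset (map_zero _) χ)).trans h3
      have h4 := h.2 (hc.toSchwartzMap (Complex.ofRealCLM.contDiff.comp h1)) hsub
      rw [key] at h4
      simp only [Complex.real_smul]
      exact h4
    have h2 : Set.EqOn (𝓕⁻ A) (fun _ ↦ 0) (Set.Iio 0) := by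
      refine Measure.eqOn_open_of_ae_eq (μ := volume) ?_ isOpen_Iio hcont.continuousOn
        continuousOn_const
      rw [EventuallyEq, ae_restrict_iff' measurableSet_Iio]
      exact h1
    exact fun t ht ↦ h2 ht
  · refine fun h ↦ ⟨isTempered_of_integrable hA, fun φ hφ ↦ ?_⟩
    rw [key, ← integral_zero ℝ ℂ]
    congr 1
    ext t
    rcases lt_or_ge t 0 with ht | ht
    · rw [h t ht, mul_zero]
    · rw [image_eq_zero_of_notMem_tsupport fun hmem ↦ not_lt.2 ht (hφ hmem), zero_mul]

/-! ### The low-pass filter and reduction to integrable functions. -/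

/-- The low-pass filter `1 / (1 + 2πix)`, the Fourier transform of a one-sided exponential. -/
noncomputable def lowPass (x : ℝ) : ℂ := (1 + 2 * Real.pi * x * Complex.I)⁻¹

theorem one_add_mul_I_ne_zero (x : ℝ) : (1 + 2 * Real.pi * x * Complex.I : ℂ) ≠ 0 := by
  intro h
  have := congrArg Complex.re h
  simp at this

theorem norm_lowPass_sq (x : ℝ) : ‖lowPass x‖ ^ 2 = (1 + (2 * Real.pi * x) ^ 2)⁻¹ := by
  rw [lowPass, norm_inv, inv_pow, ← Complex.normSq_eq_norm_sq, Complex.normSq_apply]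
  simp [sq]

theorem integrable_norm_lowPass_sq : Integrable fun x ↦ ‖lowPass x‖ ^ 2 := by
  simp_rw [norm_lowPass_sq]
  exact integrable_inv_one_add_sq.comp_mul_left' (by positivity)

theorem norm_lowPass_le (x : ℝ) : ‖lowPass x‖ ≤ 2 / (1 + |x|) := by
  refine abs_le_of_sq_le_sq' ?_ (by positivity) |>.2
  rw [norm_lowPass_sq, div_pow, inv_le_comm₀ (by positivity) (by positivity), inv_div,
    div_le_iff₀ (by positivity)]
  have h1 : (1 : ℝ) ≤ Real.pi ^ 2 := by nlinarith [Real.pi_gt_three]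
  nlinarith [sq_abs x, sq_nonneg (|x| - 1), mul_le_mul_of_nonneg_right h1 (sq_nonneg x)]

theorem norm_lowPass_le_one (x : ℝ) : ‖lowPass x‖ ≤ 1 := by
  refine abs_le_of_sq_le_sq' ?_ zero_le_one |>.2
  rw [norm_lowPass_sq, one_pow]
  exact inv_le_one_of_one_le₀ (by nlinarith [sq_nonneg (2 * Real.pi * x)])

theorem continuous_lowPass : Continuous lowPass :=
  Continuous.inv₀ (by fun_prop) one_add_mul_I_ne_zero

theorem hasTemperateGrowth_lowPass : lowPass.HasTemperateGrowth := by
  have h1 : (fun x : ℝ ↦ (1 + ‖2 * Real.pi * x‖ ^ 2) ^ (-1 : ℝ)).HasTemperateGrowth :=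
    (Function.hasTemperateGrowth_one_add_norm_sq_rpow ℝ (-1)).comp
      (by fun_prop : (fun x : ℝ ↦ 2 * Real.pi * x).HasTemperateGrowth)
  have h2 : lowPass = fun x ↦ ((1 + ‖2 * Real.pi * x‖ ^ 2) ^ (-1 : ℝ) : ℝ) *
      (1 - 2 * Real.pi * x * Complex.I) := by
    ext x
    have h3 := one_add_mul_I_ne_zero x
    rw [lowPass, Real.rpow_neg_one, Real.norm_eq_abs, sq_abs]
    push_cast
    have h4 : (1 + (2 * Real.pi * x) ^ 2 : ℂ) ≠ 0 := by
      have : (1 + (2 * Real.pi * x) ^ 2 : ℝ) ≠ 0 := by positivity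
      exact_mod_cast this
    have h5 : (1 + 2 * Real.pi * x * Complex.I) * (1 - 2 * Real.pi * x * Complex.I) =
        (1 + (2 * Real.pi * x) ^ 2 : ℂ) := by
      linear_combination -(2 * Real.pi * x : ℂ) ^ 2 * Complex.I_sq
    rw [← h5] at h4 ⊢
    rw [mul_inv, inv_mul_cancel_right₀ (right_ne_zero_of_mul h4)]
  rw [h2]
  fun_prop

/-- On the ray, `exp (-t) * ψ t` is constant, and it tends to 0 because `ψ` is bounded. -/
theorem eq_zero_of_deriv_eq_self {ψ : 𝓢(ℝ, ℂ)} {c : ℝ} (h : ∀ t > c, deriv ψ t = ψ t)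
    {t : ℝ} (ht : c < t) : ψ t = 0 := by
  have hconst : ∀ s ∈ Set.Ici t, Complex.exp (-s) * ψ s = Complex.exp (-t) * ψ t := by
    intro s hs
    refine constant_of_has_deriv_right_zero (f := fun s : ℝ ↦ Complex.exp (-s) * ψ s) (b := s)
      ?_ (fun x hx ↦ ?_) s ⟨hs, le_rfl⟩
    · exact Continuous.continuousOn (by fun_prop)
    · have h1 : HasDerivAt (fun s : ℝ ↦ Complex.exp (-s)) (-Complex.exp (-x)) x := by
        simpa using ((Complex.ofRealCLM.hasDerivAt (x := x)).neg).cexp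
      have h2 := h1.mul (ψ.differentiableAt (x := x)).hasDerivAt
      rw [h x (lt_of_lt_of_le ht hx.1)] at h2
      rw [show -Complex.exp (-x) * ψ x + Complex.exp (-x) * ψ x = 0 by ring] at h2
      exact h2.hasDerivWithinAt
  have hlim : Tendsto (fun s : ℝ ↦ Complex.exp (-s) * ψ s) atTop (𝓝 0) := by
    rw [tendsto_zero_iff_norm_tendsto_zero]
    have h1 : Tendsto (fun s : ℝ ↦ Real.exp (-s) * SchwartzMap.seminorm ℂ 0 0 ψ) atTop (𝓝 0) := by
      simpa using (Real.tendsto_exp_neg_atTop_nhds_zero).mul_const _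
    refine squeeze_zero (fun _ ↦ norm_nonneg _) (fun s ↦ ?_) h1
    rw [norm_mul, Complex.norm_exp]
    simp only [Complex.neg_re, Complex.ofReal_re]
    gcongr
    exact ψ.norm_le_seminorm ℂ s
  have h0 : Complex.exp (-t) * ψ t = 0 := by
    refine tendsto_nhds_unique (tendsto_const_nhds.congr' ?_) hlim
    filter_upwards [eventually_ge_atTop t] with s hs using (hconst s hs).symm
  exact (mul_eq_zero.1 h0).resolve_left (Complex.exp_ne_zero _)

theorem fourierInv_sub_deriv (ψ : 𝓢(ℝ, ℂ)) (x : ℝ) :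
    𝓕⁻ (ψ - SchwartzMap.derivCLM ℂ ℂ ψ) x = (1 + 2 * Real.pi * x * Complex.I) * 𝓕⁻ ψ x := by
  have h1 : 𝓕⁻ (ψ - SchwartzMap.derivCLM ℂ ℂ ψ) x =
      𝓕⁻ ψ x - 𝓕⁻ (SchwartzMap.derivCLM ℂ ℂ ψ) x := by
    exact congrArg (fun f : 𝓢(ℝ, ℂ) ↦ f x) (map_sub (FourierTransform.fourierInvCLM ℂ 𝓢(ℝ, ℂ)) ψ _)
  have h2 := congrFun (Real.fourier_deriv ψ.integrable ψ.differentiable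
    (SchwartzMap.derivCLM ℂ ℂ ψ).integrable) (-x)
  have h3 : 𝓕⁻ (SchwartzMap.derivCLM ℂ ℂ ψ) x = 𝓕 (deriv ψ) (-x) := by
    rw [SchwartzMap.fourierInv_coe, Real.fourierInv_eq_fourier_neg]
    rfl
  rw [h1, h3, h2, SchwartzMap.fourierInv_coe, Real.fourierInv_eq_fourier_neg, smul_eq_mul]
  push_cast
  ring

/-- The function `ψ` solves `ψ - ψ' = φ`. To the right of the support of `φ` it is a multiple of
`exp t`, and boundedness forces that multiple to be 0. -/
theorem exists_schwartz_mul_lowPass {φ : 𝓢(ℝ, ℂ)} (hφ : tsupport φ ⊆ Set.Iio 0) :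
    ∃ ψ : 𝓢(ℝ, ℂ), tsupport ψ ⊆ Set.Iio 0 ∧ ∀ x, 𝓕⁻ ψ x = lowPass x * 𝓕⁻ φ x := by
  set ψ : 𝓢(ℝ, ℂ) := 𝓕 (SchwartzMap.smulLeftCLM ℂ lowPass (𝓕⁻ φ)) with hψ
  have hψx : ∀ x, 𝓕⁻ ψ x = lowPass x * 𝓕⁻ φ x := fun x ↦ by
    rw [hψ, FourierTransform.fourierInv_fourier_eq,
      SchwartzMap.smulLeftCLM_apply_apply hasTemperateGrowth_lowPass, smul_eq_mul]
  have hode : ψ - SchwartzMap.derivCLM ℂ ℂ ψ = φ := by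
    have : 𝓕⁻ (ψ - SchwartzMap.derivCLM ℂ ℂ ψ) = 𝓕⁻ φ := by
      ext x
      rw [fourierInv_sub_deriv, hψx, lowPass, mul_inv_cancel_left₀ (one_add_mul_I_ne_zero x)]
    have h2 := congrArg (fun f : 𝓢(ℝ, ℂ) ↦ 𝓕 f) this
    simpa only [FourierTransform.fourier_fourierInv_eq] using h2
  refine ⟨ψ, ?_, hψx⟩
  -- The closed support of `φ` misses 0, which leaves a gap `(-δ, 0)`; the gap keeps the closed
  -- support of `ψ` inside the open half-line.
  have hnhds : (tsupport φ)ᶜ ∈ 𝓝 (0 : ℝ) :=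
    (isClosed_tsupport φ).isOpen_compl.mem_nhds fun h ↦ lt_irrefl (0 : ℝ) (hφ h)
  obtain ⟨δ, hδ, hball⟩ := Metric.mem_nhds_iff.1 hnhds
  have hφ0 : ∀ t > -δ, φ t = 0 := fun t ht ↦ by
    refine image_eq_zero_of_notMem_tsupport fun hmem ↦ ?_
    have h0 : t < 0 := hφ hmem
    refine hball ?_ hmem
    rw [Metric.mem_ball, Real.dist_eq, sub_zero, abs_of_neg h0]
    linarith
  have hψ0 : ∀ t, -δ < t → ψ t = 0 := fun t ht ↦
    eq_zero_of_deriv_eq_self (c := -δ) (fun s hs ↦ by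
      have := congrArg (fun f : 𝓢(ℝ, ℂ) ↦ f s) hode
      simp only [sub_apply, SchwartzMap.derivCLM_apply, hφ0 s hs] at this
      exact (sub_eq_zero.1 this).symm) ht
  have hsub : Function.support ψ ⊆ Set.Iic (-δ) := fun t ht ↦ by
    by_contra hlt
    exact ht (hψ0 t (not_le.1 hlt))
  exact (closure_minimal hsub isClosed_Iic).trans (Set.Iic_subset_Iio.2 (by linarith))

theorem IsTempered.mul_lowPass {A : ℝ → ℂ} (hA : IsTempered A) :
    IsTempered fun x ↦ A x * lowPass x := by
  obtain ⟨n, hn⟩ := hA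
  refine ⟨n, (hn.mul_bdd (c := 1) continuous_lowPass.aestronglyMeasurable
    (Eventually.of_forall norm_lowPass_le_one)).congr (Eventually.of_forall fun x ↦ ?_)⟩
  ring

theorem IsTemperedCausal.mul_lowPass {A : ℝ → ℂ} (hA : IsTemperedCausal A) :
    IsTemperedCausal fun x ↦ A x * lowPass x := by
  refine ⟨hA.1.mul_lowPass, fun φ hφ ↦ ?_⟩
  obtain ⟨ψ, hψ, h⟩ := exists_schwartz_mul_lowPass hφ
  rw [← hA.2 ψ hψ]
  simp_rw [h, mul_assoc]

theorem IsTemperedCausal.mul_lowPass_pow {A : ℝ → ℂ} (hA : IsTemperedCausal A) (n : ℕ) :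
    IsTemperedCausal fun x ↦ A x * lowPass x ^ n := by
  induction n with
  | zero => simpa using hA
  | succ n ih => simpa only [pow_succ, ← mul_assoc] using ih.mul_lowPass

/-- Testing the filtered function against `φ - φ'`, again supported in the negative half-line,
cancels the filter. -/
theorem IsTemperedCausal.of_mul_lowPass {A : ℝ → ℂ} (hA : IsTempered A)
    (h : IsTemperedCausal fun x ↦ A x * lowPass x) : IsTemperedCausal A := by
  refine ⟨hA, fun φ hφ ↦ ?_⟩
  rw [← h.2 (φ - SchwartzMap.derivCLM ℂ ℂ φ) ?_]
  · congr 1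
    ext x
    simp only [lowPass]
    rw [fourierInv_sub_deriv, mul_assoc, inv_mul_cancel_left₀ (one_add_mul_I_ne_zero x)]
  · have h1 : tsupport (SchwartzMap.derivCLM ℂ ℂ φ) ⊆ Set.Iio 0 :=
      (SchwartzMap.tsupport_derivCLM_subset ℂ φ).trans hφ
    exact (tsupport_sub (φ : ℝ → ℂ) (SchwartzMap.derivCLM ℂ ℂ φ : ℝ → ℂ)).trans
      (Set.union_subset hφ h1)

theorem IsTempered.mul_lowPass_pow {A : ℝ → ℂ} (hA : IsTempered A) (n : ℕ) :
    IsTempered fun x ↦ A x * lowPass x ^ n := by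
  induction n with
  | zero => simpa using hA
  | succ n ih => simpa only [pow_succ, ← mul_assoc] using ih.mul_lowPass

theorem IsTemperedCausal.of_mul_lowPass_pow {A : ℝ → ℂ} (hA : IsTempered A) (n : ℕ)
    (h : IsTemperedCausal fun x ↦ A x * lowPass x ^ n) : IsTemperedCausal A := by
  induction n with
  | zero => simpa using h
  | succ n ih =>
    refine ih (.of_mul_lowPass (hA.mul_lowPass_pow n) ?_)
    simpa only [pow_succ, ← mul_assoc] using h

theorem IsTempered.exists_integrable_mul_lowPass_pow {A : ℝ → ℂ} (hA : IsTempered A) :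
    ∃ n : ℕ, ∀ m ≥ n, Integrable fun x ↦ A x * lowPass x ^ m := by
  obtain ⟨n, hn⟩ := hA
  refine ⟨n, fun m hm ↦ ?_⟩
  have h := hn.mul_bdd (c := 2 ^ n) (g := fun x ↦ ((1 + |x| : ℝ) : ℂ) ^ n * lowPass x ^ m)
    (Continuous.aestronglyMeasurable (by have := continuous_lowPass; fun_prop))
    (Eventually.of_forall fun x ↦ ?_)
  · refine h.congr (Eventually.of_forall fun x ↦ ?_)
    have e1 : ((1 + |x| : ℝ) : ℂ) ≠ 0 := by
      exact_mod_cast (by positivity : (1 + |x| : ℝ) ≠ 0)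
    push_cast at e1 ⊢
    field_simp
  · rw [norm_mul, norm_pow, norm_pow, Complex.norm_real, Real.norm_of_nonneg (by positivity)]
    calc (1 + |x|) ^ n * ‖lowPass x‖ ^ m ≤ (1 + |x|) ^ n * ‖lowPass x‖ ^ n := by
          gcongr ?_ * ?_
          exact pow_le_pow_of_le_one (norm_nonneg _) (norm_lowPass_le_one x) hm
      _ ≤ (1 + |x|) ^ n * (2 / (1 + |x|)) ^ n := by
          gcongr
          exact norm_lowPass_le x
      _ = 2 ^ n := by
          rw [← mul_pow, mul_div_cancel₀]
          positivity

/-- The geometric mean of `‖A‖` and `‖lowPass‖ ^ 2` is at most their sum, and both are integrable.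
-/
theorem integrable_sqrt_norm_mul_lowPass_sq {A : ℝ → ℂ} (hA : Integrable A) :
    Integrable fun x ↦ √‖A x * lowPass x ^ 2‖ := by
  refine (hA.norm.add integrable_norm_lowPass_sq).mono'
    (Real.continuous_sqrt.comp_aestronglyMeasurable
      (hA.aestronglyMeasurable.mul (continuous_lowPass.pow 2).aestronglyMeasurable).norm)
    (Eventually.of_forall fun x ↦ ?_)
  rw [Real.norm_of_nonneg (Real.sqrt_nonneg _), norm_mul, norm_pow, Pi.add_apply]
  refine Real.sqrt_le_iff.2 ⟨by positivity, ?_⟩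
  nlinarith [norm_nonneg (A x), sq_nonneg ‖lowPass x‖,
    mul_nonneg (norm_nonneg (A x)) (sq_nonneg ‖lowPass x‖)]

/-! ### Products of tempered causal functions and the causality criterion. -/

theorem IsTemperedCausal.mul {A B : ℝ → ℂ} (hA : IsTemperedCausal A) (hB : IsTemperedCausal B)
    (hAB : IsTempered fun x ↦ A x * B x) : IsTemperedCausal fun x ↦ A x * B x := by
  obtain ⟨a, ha⟩ := hA.1.exists_integrable_mul_lowPass_pow
  obtain ⟨b, hb⟩ := hB.1.exists_integrable_mul_lowPass_pow
  obtain ⟨c, hc⟩ := hAB.exists_integrable_mul_lowPass_pow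
  set N := a + b + c with hN
  -- The power `N` secures integrability; the two further factors make the square root of the
  -- modulus integrable.
  have hA1 : IsIntegrableCausal fun x ↦ A x * lowPass x ^ (N + 2) :=
    ⟨ha _ (by omega), (isTemperedCausal_iff_of_integrable (ha _ (by omega))).1
      (hA.mul_lowPass_pow _)⟩
  have hB1 : IsIntegrableCausal fun x ↦ B x * lowPass x ^ (N + 2) :=
    ⟨hb _ (by omega), (isTemperedCausal_iff_of_integrable (hb _ (by omega))).1
      (hB.mul_lowPass_pow _)⟩
  have hAs := integrable_sqrt_norm_mul_lowPass_sq (ha N (by omega))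
  have hBs := integrable_sqrt_norm_mul_lowPass_sq (hb N (by omega))
  simp only [mul_assoc, ← pow_add] at hAs hBs
  have e : ∀ x, A x * lowPass x ^ (N + 2) * (B x * lowPass x ^ (N + 2)) =
      A x * B x * lowPass x ^ (N + 2 + (N + 2)) := fun x ↦ by ring
  have hi := hc (N + 2 + (N + 2)) (by omega)
  have h := hA1.mul_of_integrable hB1 hAs hBs (by simpa only [e] using hi)
  simp only [e] at h
  exact .of_mul_lowPass_pow hAB _ ((isTemperedCausal_iff_of_integrable hi).2 h.2)

theorem isCausal_iff {H : ℝ → ℂ} (hH : IsTempered H) :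
    IsCausal H ↔ IsTemperedCausal fun ν ↦ H (2 * Real.pi * ν) := by
  rw [← isVanishingOn_impulseResponse_iff hH]
  exact ⟨fun ⟨_, h⟩ ↦ h, fun h ↦ ⟨hH, h⟩⟩

theorem inverseFourierIntegral_eq (H : ℝ → ℂ) (t : ℝ) :
    inverseFourierIntegral H t = 𝓕⁻ (fun ν ↦ H (2 * Real.pi * ν)) t := by
  rw [fourierInv_real_eq_integral, inverseFourierIntegral]
  have h := Measure.integral_comp_mul_left
    (fun ω : ℝ ↦ H ω * Complex.exp (Complex.I * ω * t)) (2 * Real.pi)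
  rw [integral_div, div_eq_inv_mul]
  rw [abs_of_nonneg (by positivity), Complex.real_smul] at h
  push_cast at h
  rw [← h]
  congr 1
  ext ν
  rw [mul_comm]
  congr 2
  push_cast
  ring

theorem IsMinimumPhase.isCausal_iff_isVanishingOn {F H : ℝ → ℂ} (hF : IsMinimumPhase F)
    (hH : IsTempered H) (hFH : IsTempered fun ω ↦ F ω * H ω) :
    IsCausal H ↔ IsVanishingOn (impulseResponse (fun ω ↦ F ω * H ω) hFH) (Set.Iio 0) := by
  obtain ⟨hne, hF1, hF2⟩ := hF
  rw [isVanishingOn_impulseResponse_iff, isCausal_iff hH]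
  have h1 := (isCausal_iff hF1.1).1 hF1
  have h2 := (isCausal_iff hF2.1).1 hF2
  have hne' : ∀ᵐ ν : ℝ, F (2 * Real.pi * ν) ≠ 0 :=
    (Measure.quasiMeasurePreserving_smul (volume : Measure ℝ)
      (by positivity : 2 * Real.pi ≠ 0)).ae hne
  have hcancel : (fun ν : ℝ ↦ (F (2 * Real.pi * ν))⁻¹ * (F (2 * Real.pi * ν) * H (2 * Real.pi * ν)))
      =ᵐ[volume] fun ν ↦ H (2 * Real.pi * ν) := by
    filter_upwards [hne'] with ν hν
    rw [inv_mul_cancel_left₀ hν]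
  refine ⟨fun h ↦ h1.mul h hFH.comp_two_pi_mul, fun h ↦ (h2.mul h ?_).congr hcancel⟩
  -- It remains to see that `F⁻¹ * (F * H)` is tempered: it agrees almost everywhere with `H`.
  obtain ⟨n, hn⟩ := hH.comp_two_pi_mul
  refine ⟨n, hn.congr ?_⟩
  filter_upwards [hcancel] with ν hν
  rw [hν]

end CausalityCheck

theorem theorem1 (F H : ℝ → ℂ)
    (hF : CausalityCheck.IsMinimumPhase F)
    (hH : CausalityCheck.IsTempered H)
    (hFH : CausalityCheck.IsTempered (fun ω ↦ F ω * H ω)) :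
    (CausalityCheck.IsCausal H ↔
      IsVanishingOn (CausalityCheck.impulseResponse (fun ω ↦ F ω * H ω) hFH) (Set.Iio 0)) ∧
    (Integrable (fun ω ↦ F ω * H ω) →
      (CausalityCheck.IsCausal H ↔
        ∀ t : ℝ, t < 0 →
          CausalityCheck.inverseFourierIntegral (fun ω ↦ F ω * H ω) t = 0)) := by
  refine ⟨hF.isCausal_iff_isVanishingOn hH hFH, fun hi ↦ ?_⟩
  rw [hF.isCausal_iff_isVanishingOn hH hFH, CausalityCheck.isVanishingOn_impulseResponse_iff,
    CausalityCheck.isTemperedCausal_iff_of_integrable (hi.comp_mul_left' (by positivity))]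
  simp_rw [CausalityCheck.inverseFourierIntegral_eq]
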